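/- Let $N=\Gamma\backslash G$ be a nilmanifold, i.e. a compact quotient of a simply connected nilpotent Lie group $G$ by a lattice $\Gamma$, whose Lie algebra $\mathfrak g$ is isomorphic to $\mathfrak h_{19}^-$, the 6-dimensional real Lie algebra that has a basis $\{f^k\}$ of the dual with $$df^1=df^2=df^3=0,\quad df^4=f^{1}\wedge f^2,\quad df^5=f^2\wedge f^3,\quad df^6=f^1\wedge f^4-f^3\wedge f^5 .$$ An invariant object on $N$ is one coming from the corresponding object on $\mathfrak g$. For a Hermitian structure $(J,g)$ put $F(X,Y)=g(X,JY)$ and $T(X,Y,Z)=JdF(X,Y,Z)=-dF(JX,JY,JZ)$. It is balanced if $d(F\wedge F)=0$. The Bismut connection is the Hermitian connection (i.e. preserving $g$ and $J$) with torsion $T$, and the Chern connection is the Hermitian connection whose torsion has no $(1,1)$-part. A basis $\{e_k\}$ of invariant vector fields with dual basis $\{e^k\}$ is adapted if it is orthonormal and $Je_1=-e_2$, $Je_3=-e_4$, $Je_5=-e_6$; it defines the $SU(3)$-structure $(J,F,\Psi)$, $\Psi=(e^1+ie^2)\wedge(e^3+ie^4)\wedge(e^5+ie^6)$. For a connection $D$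 with curvature forms $\Omega^i_j$ in this basis put $p_1(D)=\frac1{8\pi^2}\sum_{i<j}\Omega^i_j\wedge\Omega^i_j$. An $SU(3)$-instanton is a connection $A$ preserving $g$, $J$ and $\Psi$ each of whose curvature forms $\Omega$ satisfies $\Omega(e_1,e_2)+\Omega(e_3,e_4)+\Omega(e_5,e_6)=0$ and $\Omega(JX,JY)=\Omega(X,Y)$. The instanton $A$ solves the Strominger system (with constant dilaton) with respect to a connection $D$ if the Bismut connection preserves $g$, $J$ and $\Psi$ (holonomy in $SU(3)$), the Hermitian structure is balanced, $A$ is an $SU(3)$-instanton, and for some constant $\alpha'>0$ $$dT=2\pi^2\alpha'\,\bigl(p_1(D)-p_1(A)\bigr).$$ **Proposition 5.7.** For every invariant complex structure $J$ on $N$ there are an invariant balanced $J$-Hermitian metric $g$, an adapted basis $\{e_k\}$, and a single non-flat invariant $SU(3)$-instanton $A$ such that $A$ solves the Strominger system both with respect to the Bismut connection and with respect to the Chern connection of $(J,g)$ (the constant $\alpha'>0$ may differ in the two systems). Moreover, $g$ and the adapted basis can be chosen so that, for some sign $\pm$ and some real $r\neq0$ and $s$ with $s^2=\sqrt{5/3}$,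 $$de^1=de^2=de^5=0,\quad de^3=\tfrac{2s}{r}\,e^1\wedge e^5,\quad de^4=\tfrac{2s}{r}\,e^2\wedge e^5,\quad de^6=\pm\tfrac{2}{rs}\,(e^1\wedge e^3+e^2\wedge e^4).$$ -/

import Mathlib

open Module
open scoped Manifold ContDiff

/-! Invariant geometry of a nilmanifold `N = Γ \ G`.

An invariant tensor field, form or connection on `N` is one that comes from a left-invariant one
on the Lie group `G`, that is, from the corresponding multilinear object on the Lie algebra `𝔤` of
left-invariant vector fields; the exterior derivative of invariant forms is the
Chevalley-Eilenberg differential. All the definitions below are about a real Lie algebra `𝔤`, and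
the theorem uses them for `𝔤 = GroupLieAlgebra (𝓡 6) G`. The index `k : Fin 6` stands for
the index `k + 1` of the usual notation `e^1, ..., e^6`. -/

namespace InvGeom

/-- A smooth Lie group is smooth enough for Mathlib's Lie algebra structure on left-invariant
vector fields. -/
instance lieGroup_minSmoothness {G : Type*} [Group G] [TopologicalSpace G]
    [ChartedSpace (EuclideanSpace ℝ (Fin 6)) G] [LieGroup (𝓡 6) ∞ G] :
    LieGroup (𝓡 6) (minSmoothness ℝ 3) G := by
  rw [minSmoothness_of_isRCLikeNormedField]
  infer_instance

noncomputable section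

variable {𝔤 : Type*} [LieRing 𝔤] [LieAlgebra ℝ 𝔤]

/-! ### Forms: wedge products and the Chevalley-Eilenberg differential -/

/-- The wedge product `α ∧ β` of two 1-forms. -/
def wedgeOne (α β : Dual ℝ 𝔤) : 𝔤 → 𝔤 → ℝ := fun X Y => α X * β Y - α Y * β X

/-- The wedge product `α ∧ β` of two 2-forms. -/
def wedgeTwo (α β : 𝔤 → 𝔤 → ℝ) : 𝔤 → 𝔤 → 𝔤 → 𝔤 → ℝ := fun X Y Z W =>
  α X Y * β Z W - α X Z * β Y W + α X W * β Y Z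
    + α Y Z * β X W - α Y W * β X Z + α Z W * β X Y

/-- The differential of a 1-form. -/
def dOne (α : Dual ℝ 𝔤) : 𝔤 → 𝔤 → ℝ := fun X Y => -α ⁅X, Y⁆

/-- The differential of a 2-form. -/
def dTwo (α : 𝔤 → 𝔤 → ℝ) : 𝔤 → 𝔤 → 𝔤 → ℝ := fun X Y Z =>
  -α ⁅X, Y⁆ Z + α ⁅X, Z⁆ Y - α ⁅Y, Z⁆ X

/-- The differential of a 3-form. -/
def dThree (α : 𝔤 → 𝔤 → 𝔤 → ℝ) : 𝔤 → 𝔤 → 𝔤 → 𝔤 → ℝ := fun X Y Z W =>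
  -α ⁅X, Y⁆ Z W + α ⁅X, Z⁆ Y W - α ⁅X, W⁆ Y Z
    - α ⁅Y, Z⁆ X W + α ⁅Y, W⁆ X Z - α ⁅Z, W⁆ X Y

/-- The differential of a 4-form. -/
def dFour (α : 𝔤 → 𝔤 → 𝔤 → 𝔤 → ℝ) : 𝔤 → 𝔤 → 𝔤 → 𝔤 → 𝔤 → ℝ := fun X Y Z W V =>
  -α ⁅X, Y⁆ Z W V + α ⁅X, Z⁆ Y W V - α ⁅X, W⁆ Y Z V + α ⁅X, V⁆ Y Z W
    - α ⁅Y, Z⁆ X W V + α ⁅Y, W⁆ X Z V - α ⁅Y, V⁆ X Z W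
    - α ⁅Z, W⁆ X Y V + α ⁅Z, V⁆ X Y W - α ⁅W, V⁆ X Y Z

/-! ### The Lie algebra -/

/-- `𝔤` is isomorphic to `𝔥₁₉⁻ = (0, 0, 0, 12, 23, 14 - 35)`: it has a basis whose dual basis
`f^1, ..., f^6` satisfies `df^1 = df^2 = df^3 = 0`, `df^4 = f^1 ∧ f^2`, `df^5 = f^2 ∧ f^3` and
`df^6 = f^1 ∧ f^4 - f^3 ∧ f^5`. -/
def IsH19Minus (𝔤 : Type*) [LieRing 𝔤] [LieAlgebra ℝ 𝔤] : Prop :=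
  ∃ f : Basis (Fin 6) ℝ 𝔤,
    dOne (f.coord 0) = 0 ∧ dOne (f.coord 1) = 0 ∧ dOne (f.coord 2) = 0 ∧
    dOne (f.coord 3) = wedgeOne (f.coord 0) (f.coord 1) ∧
    dOne (f.coord 4) = wedgeOne (f.coord 1) (f.coord 2) ∧
    dOne (f.coord 5) = wedgeOne (f.coord 0) (f.coord 3) - wedgeOne (f.coord 2) (f.coord 4)

/-! ### Hermitian structures -/

/-- A complex structure on `𝔤`: `J² = -Id` and the Nijenhuis condition. -/
structure IsComplexStructure (J : 𝔤 →ₗ[ℝ] 𝔤) : Prop where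
  sq : ∀ X, J (J X) = -X
  nijenhuis : ∀ X Y, ⁅J X, J Y⁆ = J ⁅J X, Y⁆ + J ⁅X, J Y⁆ + ⁅X, Y⁆

/-- `g` is an inner product on `𝔤` that is compatible with `J`. -/
structure IsHermitianMetric (J : 𝔤 →ₗ[ℝ] 𝔤) (g : 𝔤 →ₗ[ℝ] 𝔤 →ₗ[ℝ] ℝ) : Prop where
  symm : ∀ X Y, g X Y = g Y X
  pos : ∀ X, X ≠ 0 → 0 < g X X
  compatible : ∀ X Y, g (J X) (J Y) = g X Y

/-- The fundamental form `F(X, Y) = g(X, JY)`. -/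
def fundForm (J : 𝔤 →ₗ[ℝ] 𝔤) (g : 𝔤 →ₗ[ℝ] 𝔤 →ₗ[ℝ] ℝ) : 𝔤 → 𝔤 → ℝ := fun X Y => g X (J Y)

/-- The Hermitian structure is balanced: `F ∧ F` is closed (in real dimension 6). -/
def IsBalanced (J : 𝔤 →ₗ[ℝ] 𝔤) (g : 𝔤 →ₗ[ℝ] 𝔤 →ₗ[ℝ] ℝ) : Prop :=
  dFour (wedgeTwo (fundForm J g) (fundForm J g)) = 0

/-- The basis `e` is adapted to `(J, g)`: it is orthonormal, and `J e₁ = -e₂`, `J e₃ = -e₄`,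
`J e₅ = -e₆`. In terms of the dual basis, with the convention `(Jα)(X) = -α(JX)`, this
says `Je^1 = -e^2`, `Je^3 = -e^4`, `Je^5 = -e^6` and `F = e^12 + e^34 + e^56`. -/
structure IsAdapted (J : 𝔤 →ₗ[ℝ] 𝔤) (g : 𝔤 →ₗ[ℝ] 𝔤 →ₗ[ℝ] ℝ) (e : Basis (Fin 6) ℝ 𝔤) : Prop where
  orthonormal : ∀ i j, g (e i) (e j) = if i = j then 1 else 0
  J_zero : J (e 0) = -e 1
  J_one : J (e 1) = e 0
  J_two : J (e 2) = -e 3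
  J_three : J (e 3) = e 2
  J_four : J (e 4) = -e 5
  J_five : J (e 5) = e 4

/-- The complex 1-form `a + i b`. -/
def complexForm (a b : Dual ℝ 𝔤) : 𝔤 → ℂ := fun X => (a X : ℂ) + Complex.I * (b X : ℂ)

/-- The (3,0)-form `Ψ = (e^1 + i e^2) ∧ (e^3 + i e^4) ∧ (e^5 + i e^6)`. If `e` is adapted to
`(J, g)`, then `(J, F, Ψ)` is a Hermitian `SU(3)`-structure. -/
def volForm (e : Basis (Fin 6) ℝ 𝔤) (X Y Z : 𝔤) : ℂ :=
  let ω₁ := complexForm (e.coord 0) (e.coord 1)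
  let ω₂ := complexForm (e.coord 2) (e.coord 3)
  let ω₃ := complexForm (e.coord 4) (e.coord 5)
  Matrix.det !![ω₁ X, ω₁ Y, ω₁ Z; ω₂ X, ω₂ Y, ω₂ Z; ω₃ X, ω₃ Y, ω₃ Z]

/-! ### Connections: `D X Y` is the covariant derivative of `Y` in the direction `X` -/

/-- The torsion `D_X Y - D_Y X - [X, Y]`. -/
def torsion (D : 𝔤 →ₗ[ℝ] 𝔤 →ₗ[ℝ] 𝔤) (X Y : 𝔤) : 𝔤 := D X Y - D Y X - ⁅X, Y⁆

/-- The curvature `R(X, Y) Z = D_X D_Y Z - D_Y D_X Z - D_[X,Y] Z`. -/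
def curv (D : 𝔤 →ₗ[ℝ] 𝔤 →ₗ[ℝ] 𝔤) (X Y Z : 𝔤) : 𝔤 := D X (D Y Z) - D Y (D X Z) - D ⁅X, Y⁆ Z

/-- The connection preserves `g` and `J`. -/
structure IsHermitianConnection (J : 𝔤 →ₗ[ℝ] 𝔤) (g : 𝔤 →ₗ[ℝ] 𝔤 →ₗ[ℝ] ℝ)
    (D : 𝔤 →ₗ[ℝ] 𝔤 →ₗ[ℝ] 𝔤) : Prop where
  metric : ∀ X Y Z, g (D X Y) Z + g Y (D X Z) = 0
  complex : ∀ X Y, D X (J Y) = J (D X Y)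

/-- The 3-form `T = JdF`, that is, `T(X, Y, Z) = -dF(JX, JY, JZ)`. -/
def torsionForm (J : 𝔤 →ₗ[ℝ] 𝔤) (g : 𝔤 →ₗ[ℝ] 𝔤 →ₗ[ℝ] ℝ) : 𝔤 → 𝔤 → 𝔤 → ℝ := fun X Y Z =>
  -dTwo (fundForm J g) (J X) (J Y) (J Z)

/-- `D` is the Bismut connection: the Hermitian connection whose torsion is the 3-form
`T = JdF`. -/
structure IsBismut (J : 𝔤 →ₗ[ℝ] 𝔤) (g : 𝔤 →ₗ[ℝ] 𝔤 →ₗ[ℝ] ℝ)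
    (D : 𝔤 →ₗ[ℝ] 𝔤 →ₗ[ℝ] 𝔤) : Prop where
  hermitian : IsHermitianConnection J g D
  torsion_eq : ∀ X Y Z, g X (torsion D Y Z) = torsionForm J g X Y Z

/-- `D` is the Chern connection: the Hermitian connection whose torsion has no (1,1)-part. -/
structure IsChern (J : 𝔤 →ₗ[ℝ] 𝔤) (g : 𝔤 →ₗ[ℝ] 𝔤 →ₗ[ℝ] ℝ)
    (D : 𝔤 →ₗ[ℝ] 𝔤 →ₗ[ℝ] 𝔤) : Prop where
  hermitian : IsHermitianConnection J g D
  torsion_eq : ∀ X Y, torsion D (J X) (J Y) = -torsion D X Y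

/-- The connection preserves `g`, `J` and `Ψ`, i.e. it is an `SU(3)`-connection, and its
holonomy is contained in `SU(3)`. -/
structure IsSU3Connection (J : 𝔤 →ₗ[ℝ] 𝔤) (g : 𝔤 →ₗ[ℝ] 𝔤 →ₗ[ℝ] ℝ) (e : Basis (Fin 6) ℝ 𝔤)
    (D : 𝔤 →ₗ[ℝ] 𝔤 →ₗ[ℝ] 𝔤) : Prop where
  hermitian : IsHermitianConnection J g D
  parallel : ∀ W X Y Z,
    volForm e (D W X) Y Z + volForm e X (D W Y) Z + volForm e X Y (D W Z) = 0

/-- The curvature 2-forms `Ω^i_j(X, Y) = g(R(X, Y) e_j, e_i)`. -/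
def curvForm (g : 𝔤 →ₗ[ℝ] 𝔤 →ₗ[ℝ] ℝ) (e : Basis (Fin 6) ℝ 𝔤) (D : 𝔤 →ₗ[ℝ] 𝔤 →ₗ[ℝ] 𝔤)
    (i j : Fin 6) : 𝔤 → 𝔤 → ℝ := fun X Y => g (curv D X Y (e j)) (e i)

/-- The form `p₁(D) = (1 / 8π²) ∑_{i < j} Ω^i_j ∧ Ω^i_j`. -/
def pontryagin (g : 𝔤 →ₗ[ℝ] 𝔤 →ₗ[ℝ] ℝ) (e : Basis (Fin 6) ℝ 𝔤) (D : 𝔤 →ₗ[ℝ] 𝔤 →ₗ[ℝ] 𝔤) :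
    𝔤 → 𝔤 → 𝔤 → 𝔤 → ℝ :=
  (1 / (8 * Real.pi ^ 2)) • ∑ i : Fin 6, ∑ j ∈ Finset.Ioi i,
    wedgeTwo (curvForm g e D i j) (curvForm g e D i j)

/-- `A` is an `SU(3)`-instanton: an `SU(3)`-connection each of whose curvature 2-forms `Ω`
satisfies `Ω(e₁, e₂) + Ω(e₃, e₄) + Ω(e₅, e₆) = 0` and `Ω(JX, JY) = Ω(X, Y)`. -/
structure IsInstanton (J : 𝔤 →ₗ[ℝ] 𝔤) (g : 𝔤 →ₗ[ℝ] 𝔤 →ₗ[ℝ] ℝ) (e : Basis (Fin 6) ℝ 𝔤)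
    (A : 𝔤 →ₗ[ℝ] 𝔤 →ₗ[ℝ] 𝔤) : Prop where
  su3 : IsSU3Connection J g e A
  primitive : ∀ i j, curvForm g e A i j (e 0) (e 1) + curvForm g e A i j (e 2) (e 3)
    + curvForm g e A i j (e 4) (e 5) = 0
  type_one_one : ∀ i j X Y, curvForm g e A i j (J X) (J Y) = curvForm g e A i j X Y

/-- The connection is flat: its curvature vanishes. -/
def IsFlat (D : 𝔤 →ₗ[ℝ] 𝔤 →ₗ[ℝ] 𝔤) : Prop := ∀ X Y Z, curv D X Y Z = 0

/-- The Strominger system with constant dilaton for the Hermitian `SU(3)`-structure given by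
`(J, g)` and the adapted basis `e`, with the instanton `A`, the connection `D` in the anomaly
cancellation condition, and the constant `α'`. -/
structure SolvesStrominger (J : 𝔤 →ₗ[ℝ] 𝔤) (g : 𝔤 →ₗ[ℝ] 𝔤 →ₗ[ℝ] ℝ) (e : Basis (Fin 6) ℝ 𝔤)
    (A D : 𝔤 →ₗ[ℝ] 𝔤 →ₗ[ℝ] 𝔤) (α' : ℝ) : Prop where
  complexStructure : IsComplexStructure J
  hermitianMetric : IsHermitianMetric J g
  adapted : IsAdapted J g e
  /-- The holonomy of the Bismut connection is contained in `SU(3)`. -/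
  gravitino : ∃ B : 𝔤 →ₗ[ℝ] 𝔤 →ₗ[ℝ] 𝔤, IsBismut J g B ∧ IsSU3Connection J g e B
  /-- The dilaton is constant, i.e. the Hermitian structure is balanced. -/
  dilatino : IsBalanced J g
  gaugino : IsInstanton J g e A
  alpha_pos : 0 < α'
  /-- `dT = 2π²α' (p₁(D) - p₁(A))`. -/
  anomaly : dThree (torsionForm J g) =
    (2 * Real.pi ^ 2 * α') • (pontryagin g e D - pontryagin g e A)

/-- The structure equations `de^1 = de^2 = de^5 = 0`, `de^3 = (2s/r) e^15`, `de^4 = (2s/r) e^25`,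
`de^6 = ε (2/(rs)) (e^13 + e^24)`, where `ε` is the sign. -/
def StructureEqs (e : Basis (Fin 6) ℝ 𝔤) (r s ε : ℝ) : Prop :=
  dOne (e.coord 0) = 0 ∧ dOne (e.coord 1) = 0 ∧ dOne (e.coord 4) = 0 ∧
  dOne (e.coord 2) = (2 * s / r) • wedgeOne (e.coord 0) (e.coord 4) ∧
  dOne (e.coord 3) = (2 * s / r) • wedgeOne (e.coord 1) (e.coord 4) ∧
  dOne (e.coord 5) = (ε * (2 / (r * s))) •
    (wedgeOne (e.coord 0) (e.coord 2) + wedgeOne (e.coord 1) (e.coord 3))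

end

end InvGeom

/-! Invariant objects live on the Lie algebra, so everything reduces to algebra on `𝔥₁₉⁻`. Let Z
span the center, put U = JZ, and call the hyperplane f² = 0 the ideal I; brackets within I are
multiples of Z. Integrability at Z says that ad U commutes with J, and this forces U outside I. Take
x with x and Jx in I, and put y = [x, U]. The Jacobi identity and integrability leave [x, y] = [Jx,
Jy] = κZ, with κ ≠ 0, as the only nonzero brackets of x, Jx, y, Jy, after removing [x, Jx] by a
change of x. Rescaling x, Jx, y, Jy while keeping U and Z gives a frame with de³ = p e¹⁵, de⁴ = p
e²⁵, de⁶ = q(e¹³ + e²⁴), where p > 0 is arbitrary and q = ±1 is the sign of κ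
(`IsH19Minus.exists_normalForm`). Declare this frame orthonormal. The metric is balanced, and the
Bismut and Chern connections are 𝔰𝔲(3)-valued for all p, q. As de⁶ is primitive of type (1,1), the
circle connection with form t e⁶ is an instanton A. Now dT and all the p₁ are combinations of e¹²³⁴
and e¹²⁵⁶. For q² = 1, comparing coefficients gives α' = 8/p², 4t² = 4 - 2p² for Bismut and α' = 8,
4t² = p² - 1 for Chern. One A serves both exactly when p² = 5/3, t² = 1/6. -/

namespace InvGeom

/-! ### Bracket relations of the normal form -/

section Bracket

theorem lie_eq_of_skew {𝔤 : Type*} [LieRing 𝔤] {X Y W : 𝔤} (h : ⁅X, Y⁆ = W) : ⁅Y, X⁆ = -W := by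
  rw [← h, lie_skew]

variable {𝔤 : Type*} [LieRing 𝔤] [LieAlgebra ℝ 𝔤]

/-- The six vectors satisfy the bracket relations dual to `StructureEqs`. -/
structure AdaptedBrackets (e : Fin 6 → 𝔤) (p q : ℝ) : Prop where
  b01 : ⁅e 0, e 1⁆ = 0
  b02 : ⁅e 0, e 2⁆ = -q • e 5
  b03 : ⁅e 0, e 3⁆ = 0
  b04 : ⁅e 0, e 4⁆ = -p • e 2
  b12 : ⁅e 1, e 2⁆ = 0
  b13 : ⁅e 1, e 3⁆ = -q • e 5
  b14 : ⁅e 1, e 4⁆ = -p • e 3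
  b23 : ⁅e 2, e 3⁆ = 0
  b24 : ⁅e 2, e 4⁆ = 0
  b34 : ⁅e 3, e 4⁆ = 0
  central : ∀ X : 𝔤, ⁅X, e 5⁆ = 0

/-- Formulated for a family rather than a basis, so that linear independence can be deduced from it.
-/
theorem AdaptedBrackets.lie_sum {e : Fin 6 → 𝔤} {p q : ℝ} (h : AdaptedBrackets e p q)
    (x y : Fin 6 → ℝ) :
    ⁅∑ i, x i • e i, ∑ i, y i • e i⁆ =
      (-p * (x 0 * y 4 - x 4 * y 0)) • e 2 + (-p * (x 1 * y 4 - x 4 * y 1)) • e 3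
        + (-q * (x 0 * y 2 - x 2 * y 0 + (x 1 * y 3 - x 3 * y 1))) • e 5 := by
  have c' : ∀ X : 𝔤, ⁅e 5, X⁆ = 0 := fun X => by simpa using lie_eq_of_skew (h.central X)
  simp only [Fin.sum_univ_six, lie_add, add_lie, lie_smul, smul_lie, lie_self, h.b01, h.b02,
    h.b03, h.b04, h.b12, h.b13, h.b14, h.b23, h.b24, h.b34, h.central, c',
    lie_eq_of_skew h.b01, lie_eq_of_skew h.b02, lie_eq_of_skew h.b03, lie_eq_of_skew h.b04,
    lie_eq_of_skew h.b12, lie_eq_of_skew h.b13, lie_eq_of_skew h.b14, lie_eq_of_skew h.b23,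
    lie_eq_of_skew h.b24, lie_eq_of_skew h.b34]
  module

/-- Bracketing a vanishing combination with other vectors isolates its coefficients as multiples of
the nonzero central vector `e 5`. -/
theorem AdaptedBrackets.linearIndependent {e : Fin 6 → 𝔤} {p q : ℝ}
    (h : AdaptedBrackets e p q) (hp : p ≠ 0) (hq : q ≠ 0) (h5 : e 5 ≠ 0) :
    LinearIndependent ℝ e := by
  rw [Fintype.linearIndependent_iff]
  intro x hx
  have key : ∀ y : Fin 6 → ℝ, (-p * (x 0 * y 4 - x 4 * y 0)) • e 2
      + (-p * (x 1 * y 4 - x 4 * y 1)) • e 3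
      + (-q * (x 0 * y 2 - x 2 * y 0 + (x 1 * y 3 - x 3 * y 1))) • e 5 = 0 := fun y => by
    rw [← h.lie_sum, hx, zero_lie]
  -- A further bracket with `e 0` kills `e 3` and `e 5` and sends `e 2` to a multiple of `e 5`.
  have e2 : ∀ y : Fin 6 → ℝ, x 0 * y 4 - x 4 * y 0 = 0 := fun y => by
    have := congrArg (fun X => ⁅e 0, X⁆) (key y)
    simpa [h.b02, h.b03, h.central, hp, hq, h5] using this
  have e3 : ∀ y : Fin 6 → ℝ, x 1 * y 4 - x 4 * y 1 = 0 := fun y => by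
    have := congrArg (fun X => ⁅e 1, X⁆) (key y)
    simpa [h.b12, h.b13, h.central, hp, hq, h5] using this
  have e5 : ∀ y : Fin 6 → ℝ, x 0 * y 2 - x 2 * y 0 + (x 1 * y 3 - x 3 * y 1) = 0 := fun y => by
    have := key y
    rw [e2, e3] at this
    simpa [hq, h5] using this
  have x0 : x 0 = 0 := by simpa using e2 (Pi.single 4 1)
  have x4 : x 4 = 0 := by simpa using e2 (Pi.single 0 1)
  have x1 : x 1 = 0 := by simpa using e3 (Pi.single 4 1)
  have x2 : x 2 = 0 := by simpa using e5 (Pi.single 0 1)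
  have x3 : x 3 = 0 := by simpa using e5 (Pi.single 1 1)
  have x5 : x 5 = 0 := by
    simpa [Fin.sum_univ_six, x0, x1, x2, x3, x4, h5] using hx
  intro i
  fin_cases i <;> assumption

end Bracket

/-! ### Complex structures on `𝔥₁₉⁻` -/

section Classification

variable {𝔤 : Type*} [LieRing 𝔤] [LieAlgebra ℝ 𝔤]

/-- The bracket of `𝔥₁₉⁻` in the coordinates of a basis as in `IsH19Minus`. -/
structure H19Brackets (f : Basis (Fin 6) ℝ 𝔤) : Prop where
  c0 : ∀ X Y : 𝔤, f.repr ⁅X, Y⁆ 0 = 0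
  c1 : ∀ X Y : 𝔤, f.repr ⁅X, Y⁆ 1 = 0
  c2 : ∀ X Y : 𝔤, f.repr ⁅X, Y⁆ 2 = 0
  c3 : ∀ X Y : 𝔤, f.repr ⁅X, Y⁆ 3 = f.repr Y 0 * f.repr X 1 - f.repr X 0 * f.repr Y 1
  c4 : ∀ X Y : 𝔤, f.repr ⁅X, Y⁆ 4 = f.repr Y 1 * f.repr X 2 - f.repr X 1 * f.repr Y 2
  c5 : ∀ X Y : 𝔤, f.repr ⁅X, Y⁆ 5 = f.repr Y 0 * f.repr X 3 - f.repr X 0 * f.repr Y 3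
    - (f.repr Y 2 * f.repr X 4 - f.repr X 2 * f.repr Y 4)

theorem IsH19Minus.exists_brackets (h : IsH19Minus 𝔤) :
    ∃ f : Basis (Fin 6) ℝ 𝔤, H19Brackets f := by
  obtain ⟨f, h0, h1, h2, h3, h4, h5⟩ := h
  refine ⟨f, ?_, ?_, ?_, ?_, ?_, ?_⟩ <;> intro X Y
  · simpa [dOne] using congrFun₂ h0 X Y
  · simpa [dOne] using congrFun₂ h1 X Y
  · simpa [dOne] using congrFun₂ h2 X Y
  · have := congrFun₂ h3 X Y
    simp only [dOne, wedgeOne, Basis.coord_apply] at this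
    linarith
  · have := congrFun₂ h4 X Y
    simp only [dOne, wedgeOne, Basis.coord_apply] at this
    linarith
  · have := congrFun₂ h5 X Y
    simp only [dOne, wedgeOne, Basis.coord_apply, Pi.sub_apply] at this
    linarith

theorem H19Brackets.central {f : Basis (Fin 6) ℝ 𝔤} (h : H19Brackets f) (X : 𝔤) :
    ⁅X, f 5⁆ = 0 := by
  refine f.ext_elem fun i => ?_
  fin_cases i <;> simp [h.c0, h.c1, h.c2, h.c3, h.c4, h.c5]

/-- Modulo the derived algebra and outside the second coordinate, brackets are central. -/
theorem H19Brackets.lie_eq_smul {f : Basis (Fin 6) ℝ 𝔤} (h : H19Brackets f) {X Y : 𝔤}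
    (hX : f.repr X 1 = 0) (hY : f.repr Y 1 = 0) : ⁅X, Y⁆ = f.repr ⁅X, Y⁆ 5 • f 5 := by
  refine f.ext_elem fun i => ?_
  fin_cases i <;> simp [h.c0, h.c1, h.c2, h.c3, h.c4, hX, hY]

variable {J : 𝔤 →ₗ[ℝ] 𝔤} {f : Basis (Fin 6) ℝ 𝔤}

/-- In the Nijenhuis identity at the central vector `f 5`, the two brackets with `f 5` itself
vanish. -/
theorem H19Brackets.lie_J_center (h : H19Brackets f) (hJ : IsComplexStructure J) (X : 𝔤) :
    ⁅J X, J (f 5)⁆ = J ⁅X, J (f 5)⁆ := by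
  simpa [h.central] using hJ.nijenhuis X (f 5)

/-- Otherwise the other noncentral coordinates of `J (f 5)` vanish too, and J would have a real
eigenvector. -/
theorem H19Brackets.J_center_ne_zero (h : H19Brackets f) (hJ : IsComplexStructure J) :
    f.repr (J (f 5)) 1 ≠ 0 := by
  intro hb
  set U := J (f 5) with hU
  -- If [X, U] = tZ then tU is itself a bracket. In each use below t is, up to sign, the coordinate
  -- of U under study, and the same coordinate of the bracket is zero, so its square vanishes.
  have key : ∀ (X : 𝔤) (t : ℝ), ⁅X, U⁆ = t • f 5 → t • U = ⁅J X, U⁆ := fun X t hX => by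
    rw [h.lie_J_center hJ, ← hU, hX, map_smul]
  have ha : f.repr U 0 = 0 := by
    have := key (f 3) (f.repr U 0) (f.ext_elem fun i => by
      fin_cases i <;> simp [h.c0, h.c1, h.c2, h.c3, h.c4, h.c5])
    simpa [h.c0] using congrArg (fun X => f.repr X 0) this
  have hc : f.repr U 2 = 0 := by
    have := key (f 4) (-f.repr U 2) (f.ext_elem fun i => by
      fin_cases i <;> simp [h.c0, h.c1, h.c2, h.c3, h.c4, h.c5])
    simpa [h.c2] using congrArg (fun X => f.repr X 2) this
  have h3 : f.repr U 3 = 0 := by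
    have := key (f 0) (-f.repr U 3) (f.ext_elem fun i => by
      fin_cases i <;> simp [h.c0, h.c1, h.c2, h.c3, h.c4, h.c5, ha, hb, hc])
    simpa [h.c3, ha, hb] using congrArg (fun X => f.repr X 3) this
  have h4 : f.repr U 4 = 0 := by
    have := key (f 2) (f.repr U 4) (f.ext_elem fun i => by
      fin_cases i <;> simp [h.c0, h.c1, h.c2, h.c3, h.c4, h.c5, ha, hb, hc])
    simpa [h.c4, hb, hc] using congrArg (fun X => f.repr X 4) this
  have hUZ : U = f.repr U 5 • f 5 := f.ext_elem fun i => by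
    fin_cases i <;> simp [ha, hb, hc, h3, h4]
  have hsq := hJ.sq (f 5)
  rw [← hU, hUZ, map_smul, ← hU, hUZ, smul_smul] at hsq
  have := congrArg (fun X => f.repr X 5) hsq
  simp at this
  nlinarith [mul_self_nonneg (f.repr U 5)]

theorem H19Brackets.lie_eq_zero {f : Basis (Fin 6) ℝ 𝔤} (h : H19Brackets f) {X Y : 𝔤}
    (x0 : f.repr X 0 = 0) (x1 : f.repr X 1 = 0) (x2 : f.repr X 2 = 0)
    (y0 : f.repr Y 0 = 0) (y1 : f.repr Y 1 = 0) (y2 : f.repr Y 2 = 0) : ⁅X, Y⁆ = 0 := by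
  rw [h.lie_eq_smul x1 y1, h.c5, x0, x2, y0, y2]
  simp

/-- The bracket relations of a vector `x` such that `x` and `J x` lie in the maximal ideal with
central brackets; here `Z` spans the center, `U = J Z` and `y = ⁅x, U⁆`. -/
structure TransverseVector (J : 𝔤 →ₗ[ℝ] 𝔤) (Z U x y : 𝔤) (κ : ℝ) : Prop where
  lie_x_U : ⁅x, U⁆ = y
  lie_Jx_U : ⁅J x, U⁆ = J y
  lie_x_y : ⁅x, y⁆ = κ • Z
  lie_Jx_Jy : ⁅J x, J y⁆ = κ • Z
  lie_x_Jy : ⁅x, J y⁆ = 0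
  lie_Jx_y : ⁅J x, y⁆ = 0
  lie_y_U : ⁅y, U⁆ = 0
  lie_Jy_U : ⁅J y, U⁆ = 0
  lie_y_Jy : ⁅y, J y⁆ = 0

/-- Integrability repeatedly equates a multiple of Z with a multiple of U = JZ; as U has a nonzero
coordinate 1 and Z does not, both are zero. -/
theorem H19Brackets.transverseVector (h : H19Brackets f) (hJ : IsComplexStructure J) {x U : 𝔤}
    (hU : J (f 5) = U) (hx : f.repr x 1 = 0) (hJx : f.repr (J x) 1 = 0) :
    TransverseVector J (f 5) U x ⁅x, U⁆ (f.repr U 1 * (f.repr x 0 ^ 2 + f.repr x 2 ^ 2)) := by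
  have hb := h.J_center_ne_zero hJ
  have hJy := h.lie_J_center hJ x
  have hyU := h.lie_J_center hJ ⁅x, U⁆
  rw [hU] at hb hJy hyU
  have y0 := h.c0 x U
  have y1 := h.c1 x U
  have y2 := h.c2 x U
  have y3 := h.c3 x U
  have y4 := h.c4 x U
  have w0 := h.c0 (J x) U
  have w1 := h.c1 (J x) U
  have w2 := h.c2 (J x) U
  rw [hJy] at w0 w1 w2
  -- Jacobi identity: [x, Jx] is central, hence commutes with U.
  have hJac : ⁅x, ⁅J x, U⁆⁆ - ⁅J x, ⁅x, U⁆⁆ = 0 := by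
    rw [← lie_lie, h.lie_eq_smul hx hJx, smul_lie, lie_eq_of_skew (h.central _)]
    simp
  rw [hJy] at hJac
  obtain ⟨y, hy⟩ : ∃ y, ⁅x, U⁆ = y := ⟨_, rfl⟩
  rw [hy] at hJy hyU y0 y1 y2 y3 y4 w0 w1 w2 hJac ⊢
  have hN := hJ.nijenhuis x y
  -- The minus sign in df⁶ makes the coefficient a sum of squares.
  have hxy : ⁅x, y⁆ = (f.repr U 1 * (f.repr x 0 ^ 2 + f.repr x 2 ^ 2)) • f 5 := by
    rw [h.lie_eq_smul hx y1, h.c5, y0, y2, y3, y4, hx]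
    congr 1
    ring
  have hJJ : ⁅J x, y⁆ + ⁅x, J y⁆ = 0 := by
    have e1 := h.lie_eq_smul hJx y1
    have e2 := h.lie_eq_smul hx w1
    have := congrArg (fun X => f.repr X 1) hN
    rw [e1, e2] at this
    simp only [map_add, map_smul, Finsupp.add_apply, Finsupp.smul_apply, h.c1, hU,
      smul_eq_mul, add_zero, ← add_mul] at this
    rw [e1, e2, ← add_smul, (mul_eq_zero.mp this.symm).resolve_right hb, zero_smul]
  have hxJy : ⁅x, J y⁆ = 0 := by
    have : (2 : ℝ) • ⁅x, J y⁆ = 0 := by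
      rw [two_smul, ← add_zero (0 : 𝔤)]
      nth_rewrite 1 [← hJJ]
      rw [← hJac]
      abel
    simpa using this
  have hJxy : ⁅J x, y⁆ = 0 := by simpa [hxJy] using hJJ
  have hν : ⁅y, U⁆ = 0 := by
    have e1 : ⁅y, U⁆ = f.repr ⁅y, U⁆ 5 • f 5 := f.ext_elem fun i => by
      fin_cases i <;> simp [h.c0, h.c1, h.c2, h.c3, h.c4, y0, y1, y2]
    have := congrArg (fun X => f.repr X 1) hyU
    rw [e1] at this
    simp only [h.c1, map_smul, Finsupp.smul_apply, smul_eq_mul, hU] at this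
    rw [e1, (mul_eq_zero.mp this.symm).resolve_right hb, zero_smul]
  refine ⟨hy, hJy, hxy, ?_, hxJy, hJxy, hν, ?_, ?_⟩
  · rw [hN, hxJy, hJxy, hxy]
    simp
  · rw [hyU, hν, map_zero]
  · exact h.lie_eq_zero y0 y1 y2 w0 w1 w2

theorem H19Brackets.exists_transverseVector (h : H19Brackets f) (hJ : IsComplexStructure J) :
    ∃ (x y : 𝔤) (κ : ℝ), κ ≠ 0 ∧ TransverseVector J (f 5) (J (f 5)) x y κ ∧ ⁅x, J x⁆ = 0 := by
  obtain ⟨U, hU⟩ : ∃ U, J (f 5) = U := ⟨_, rfl⟩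
  have hb := h.J_center_ne_zero hJ
  rw [hU] at hb ⊢
  -- Adding a multiple of Z to `f 0` changes Jx by that multiple of U, which can cancel coordinate
  -- 1.
  obtain ⟨x, hx, hJx, x0⟩ : ∃ x, f.repr x 1 = 0 ∧ f.repr (J x) 1 = 0 ∧ f.repr x 0 = 1 := by
    refine ⟨f 0 + (-(f.repr (J (f 0)) 1 / f.repr U 1)) • f 5, by simp, ?_, by simp⟩
    simp only [map_add, map_smul, Finsupp.add_apply, Finsupp.smul_apply, smul_eq_mul, hU]
    field_simp
    ring
  have T := h.transverseVector hJ hU hx hJx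
  have hκ : f.repr U 1 * (f.repr x 0 ^ 2 + f.repr x 2 ^ 2) ≠ 0 :=
    mul_ne_zero hb (by rw [x0]; positivity)
  have y1 := h.c1 x U
  have w0 : f.repr (J ⁅x, U⁆) 0 = 0 := by rw [← T.lie_Jx_U]; exact h.c0 _ _
  have w1 : f.repr (J ⁅x, U⁆) 1 = 0 := by rw [← T.lie_Jx_U]; exact h.c1 _ _
  have hτ := h.lie_eq_smul hx hJx
  generalize f.repr ⁅x, J x⁆ 5 = τ at hτ
  generalize f.repr U 1 * (f.repr x 0 ^ 2 + f.repr x 2 ^ 2) = κ at T hκ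
  generalize ⁅x, U⁆ = y at T y1 w0 w1
  -- With [x, Jx] = τZ, the two cross terms [x, y] and [Jy, Jx] of the new bracket each contribute
  -- -τ/2.
  obtain ⟨x', hx'⟩ : ∃ x', x + (τ / (2 * κ)) • J y = x' := ⟨_, rfl⟩
  have hJx' : J x' = J x - (τ / (2 * κ)) • y := by
    rw [← hx', map_add, map_smul, hJ.sq, smul_neg, sub_eq_add_neg]
  have x'0 : f.repr x' 0 = 1 := by simp [← hx', x0, w0]
  refine ⟨x', _, _, ?_, h.transverseVector hJ hU ?_ ?_, ?_⟩
  · exact mul_ne_zero hb (by rw [x'0]; positivity)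
  · simp [← hx', hx, w1]
  · simp [hJx', hJx, y1]
  · rw [hJx', ← hx']
    simp only [lie_sub, add_lie, smul_lie, lie_smul, hτ, T.lie_x_y, lie_eq_of_skew T.lie_y_Jy,
      lie_eq_of_skew T.lie_Jx_Jy]
    match_scalars
    field_simp
    ring

/-- Every complex structure on `𝔥₁₉⁻` has a basis with `J e₁ = -e₂`, `J e₃ = -e₄`, `J e₅ = -e₆`
and normalized structure constants. -/
theorem IsH19Minus.exists_normalForm (h : IsH19Minus 𝔤) (hJ : IsComplexStructure J) {p : ℝ}
    (hp : 0 < p) :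
    ∃ (e : Basis (Fin 6) ℝ 𝔤) (ε : ℝ), (ε = 1 ∨ ε = -1) ∧ AdaptedBrackets e p ε ∧
      J (e 0) = -e 1 ∧ J (e 2) = -e 3 ∧ J (e 4) = -e 5 := by
  obtain ⟨f, hf⟩ := h.exists_brackets
  obtain ⟨x, y, κ, hκ, T, hxJ⟩ := hf.exists_transverseVector hJ
  obtain ⟨ε, hε, hεκ⟩ : ∃ ε : ℝ, (ε = 1 ∨ ε = -1) ∧ κ = ε * |κ| := by
    rcases lt_or_gt_of_ne hκ with h' | h'
    · exact ⟨-1, Or.inr rfl, by rw [abs_of_neg h']; ring⟩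
    · exact ⟨1, Or.inl rfl, by rw [abs_of_pos h']; ring⟩
  -- The scale c makes [e₁, e₃] = -(c²κ/p)Z equal to -εZ; a real c exists because ε has the sign of
  -- κ.
  obtain ⟨c, hc⟩ : ∃ c : ℝ, c ^ 2 * κ = p * ε := by
    have hκ' : |κ| ≠ 0 := abs_ne_zero.mpr hκ
    refine ⟨√(p / |κ|), ?_⟩
    rw [Real.sq_sqrt (by positivity)]
    nth_rewrite 2 [hεκ]
    field_simp
  let v : Fin 6 → 𝔤 := ![c • x, -(c • J x), (-(c / p)) • y, (c / p) • J y, J (f 5), f 5]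
  have hk : c * (c / p) * κ = ε := by
    field_simp
    linarith
  have hv : AdaptedBrackets v p ε := by
    have hp' := hp.ne'
    refine ⟨?_, ?_, ?_, ?_, ?_, ?_, ?_, ?_, ?_, ?_, ?_⟩
    · simp [v, hxJ]
    · simp [v, T.lie_x_y, smul_smul, ← hk]; ring_nf
    · simp [v, T.lie_x_Jy]
    · simp [v, T.lie_x_U, smul_smul]; field_simp
    · simp [v, T.lie_Jx_y]
    · simp [v, T.lie_Jx_Jy, smul_smul, ← hk]; ring_nf
    · simp [v, T.lie_Jx_U, smul_smul]; field_simp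
    · simp [v, T.lie_y_Jy]
    · simp [v, T.lie_y_U]
    · simp [v, T.lie_Jy_U]
    · exact hf.central
  have hε0 : ε ≠ 0 := by rcases hε with rfl | rfl <;> norm_num
  have hli := hv.linearIndependent hp.ne' hε0 (f.ne_zero 5)
  have hcard : Fintype.card (Fin 6) = finrank ℝ 𝔤 := (finrank_eq_card_basis f).symm
  refine ⟨basisOfLinearIndependentOfCardEqFinrank hli hcard, ε, hε, ?_, ?_, ?_, ?_⟩
  · rwa [coe_basisOfLinearIndependentOfCardEqFinrank]
  · simp [v]
  · simp [v]
  · simp [v, hJ.sq]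

end Classification

/-! ### Hermitian geometry of an orthonormal frame and `SU(3)`-connections -/

section Frame

variable {𝔤 : Type*} [LieRing 𝔤] [LieAlgebra ℝ 𝔤]

/-- The inner product for which the basis `e` is orthonormal. -/
noncomputable def frameMetric (e : Basis (Fin 6) ℝ 𝔤) : 𝔤 →ₗ[ℝ] 𝔤 →ₗ[ℝ] ℝ :=
  LinearMap.mk₂ ℝ (fun X Y => ∑ i, e.repr X i * e.repr Y i)
    (fun X X' Y => by simp [add_mul, Finset.sum_add_distrib])
    (fun c X Y => by simp [mul_assoc, Finset.mul_sum])
    (fun X Y Y' => by simp [mul_add, Finset.sum_add_distrib])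
    (fun c X Y => by simp [mul_left_comm, Finset.mul_sum])

theorem frameMetric_apply (e : Basis (Fin 6) ℝ 𝔤) (X Y : 𝔤) :
    frameMetric e X Y = ∑ i, e.repr X i * e.repr Y i := rfl

theorem frameMetric_basis_right (e : Basis (Fin 6) ℝ 𝔤) (X : 𝔤) (i : Fin 6) :
    frameMetric e X (e i) = e.repr X i := by
  simp [frameMetric_apply, Finsupp.single_apply]

/-- The coordinates of the action on `ℝ⁶ = ℂ³` of the element of `𝔰𝔲(3)` with parameters `u`. -/
def suThreeCoord (u : Fin 8 → ℝ) (x : Fin 6 → ℝ) : Fin 6 → ℝ :=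
  ![u 6 * x 1 + u 0 * x 2 + u 1 * x 3 + u 2 * x 4 + u 3 * x 5,
    -u 6 * x 0 - u 1 * x 2 + u 0 * x 3 - u 3 * x 4 + u 2 * x 5,
    -u 0 * x 0 + u 1 * x 1 + u 7 * x 3 + u 4 * x 4 + u 5 * x 5,
    -u 1 * x 0 - u 0 * x 1 - u 7 * x 2 - u 5 * x 4 + u 4 * x 5,
    -u 2 * x 0 + u 3 * x 1 - u 4 * x 2 + u 5 * x 3 - (u 6 + u 7) * x 5,
    -u 3 * x 0 - u 2 * x 1 - u 5 * x 2 - u 4 * x 3 + (u 6 + u 7) * x 4]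

/-- The representation of `𝔰𝔲(3)`, parametrized by `ℝ⁸`, on `𝔤` given by the basis `e`. -/
noncomputable def suThree (e : Basis (Fin 6) ℝ 𝔤) : (Fin 8 → ℝ) →ₗ[ℝ] 𝔤 →ₗ[ℝ] 𝔤 :=
  LinearMap.mk₂ ℝ (fun u X => e.equivFun.symm (suThreeCoord u (e.repr X)))
    (fun u u' X => by
      rw [← map_add]
      congr 1
      ext i
      fin_cases i <;> simp [suThreeCoord] <;> ring)
    (fun c u X => by
      rw [← map_smul]
      congr 1
      ext i
      fin_cases i <;> simp [suThreeCoord] <;> ring)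
    (fun u X X' => by
      rw [← map_add]
      congr 1
      ext i
      fin_cases i <;> simp [suThreeCoord] <;> ring)
    (fun c u X => by
      rw [← map_smul]
      congr 1
      ext i
      fin_cases i <;> simp [suThreeCoord] <;> ring)

theorem repr_suThree (e : Basis (Fin 6) ℝ 𝔤) (u : Fin 8 → ℝ) (X : 𝔤) (i : Fin 6) :
    e.repr (suThree e u X) i = suThreeCoord u (e.repr X) i := by
  rw [← e.equivFun_apply]
  exact congrFun (e.equivFun.apply_symm_apply _) i

/-- The bracket of `𝔰𝔲(3)` in the parametrization `suThreeCoord`. -/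
def suThreeBracket (u v : Fin 8 → ℝ) : Fin 8 → ℝ :=
  let m : (Fin 8 → ℝ) → (Fin 8 → ℝ) → Fin 8 → ℝ := fun u v =>
    ![-u 6 * v 1 - u 1 * v 7 - u 2 * v 4 - u 3 * v 5,
      u 6 * v 0 + u 0 * v 7 + u 2 * v 5 - u 3 * v 4,
      -u 6 * v 3 + u 0 * v 4 - u 1 * v 5 + u 3 * (v 6 + v 7),
      u 6 * v 2 + u 0 * v 5 + u 1 * v 4 - u 2 * (v 6 + v 7),
      -u 0 * v 2 - u 1 * v 3 - u 7 * v 5 + u 5 * (v 6 + v 7),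
      -u 0 * v 3 + u 1 * v 2 + u 7 * v 4 - u 4 * (v 6 + v 7),
      u 0 * v 1 - u 1 * v 0 + (u 2 * v 3 - u 3 * v 2),
      -u 0 * v 1 + u 1 * v 0 + (u 4 * v 5 - u 5 * v 4)]
  m u v - m v u

theorem suThree_bracket (e : Basis (Fin 6) ℝ 𝔤) (u v : Fin 8 → ℝ) (X : 𝔤) :
    suThree e u (suThree e v X) - suThree e v (suThree e u X) =
      suThree e (suThreeBracket u v) X := by
  have h : ∀ u X i, e.repr (suThree e u X) i = suThreeCoord u (e.repr X) i := repr_suThree e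
  have h' : ∀ u X, (e.repr (suThree e u X) : Fin 6 → ℝ) = suThreeCoord u (e.repr X) :=
    fun u X => funext (h u X)
  refine e.ext_elem fun i => ?_
  rw [map_sub, Finsupp.sub_apply, h, h, h, h', h']
  fin_cases i <;> simp [suThreeCoord, suThreeBracket] <;> ring

variable {J : 𝔤 →ₗ[ℝ] 𝔤} {e : Basis (Fin 6) ℝ 𝔤}

/-- `J e₁ = -e₂`, `J e₃ = -e₄` and `J e₅ = -e₆`, in coordinates. -/
structure JCoords (J : 𝔤 →ₗ[ℝ] 𝔤) (e : Basis (Fin 6) ℝ 𝔤) : Prop where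
  c0 : ∀ X, e.repr (J X) 0 = e.repr X 1
  c1 : ∀ X, e.repr (J X) 1 = -e.repr X 0
  c2 : ∀ X, e.repr (J X) 2 = e.repr X 3
  c3 : ∀ X, e.repr (J X) 3 = -e.repr X 2
  c4 : ∀ X, e.repr (J X) 4 = e.repr X 5
  c5 : ∀ X, e.repr (J X) 5 = -e.repr X 4

theorem IsComplexStructure.jCoords (hJ : IsComplexStructure J) (h0 : J (e 0) = -e 1)
    (h2 : J (e 2) = -e 3) (h4 : J (e 4) = -e 5) : JCoords J e := by
  have h1 : J (e 1) = e 0 := by rw [← neg_eq_iff_eq_neg.mpr h0, map_neg, hJ.sq, neg_neg]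
  have h3 : J (e 3) = e 2 := by rw [← neg_eq_iff_eq_neg.mpr h2, map_neg, hJ.sq, neg_neg]
  have h5 : J (e 5) = e 4 := by rw [← neg_eq_iff_eq_neg.mpr h4, map_neg, hJ.sq, neg_neg]
  have key : ∀ X i, e.repr (J X) i = e.repr (∑ j, e.repr X j • J (e j)) i := fun X i => by
    conv_lhs => rw [← e.sum_repr X]
    simp only [map_sum, map_smul]
  constructor <;> intro X <;> rw [key] <;>
    simp [Fin.sum_univ_six, h0, h1, h2, h3, h4, h5]

theorem JCoords.isHermitianMetric (h : JCoords J e) : IsHermitianMetric J (frameMetric e) where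
  symm X Y := by simp only [frameMetric_apply, mul_comm]
  pos X hX := by
    have hne : ∃ i ∈ Finset.univ, 0 < e.repr X i * e.repr X i := by
      by_contra! H
      refine hX (e.ext_elem fun i => ?_)
      have := H i (Finset.mem_univ i)
      simpa using le_antisymm this (mul_self_nonneg _)
    exact Finset.sum_pos' (fun i _ => mul_self_nonneg _) hne
  compatible X Y := by
    simp only [frameMetric_apply, Fin.sum_univ_six, h.c0, h.c1, h.c2, h.c3, h.c4, h.c5]
    ring

theorem JCoords.isAdapted (h : JCoords J e) : IsAdapted J (frameMetric e) e where
  orthonormal i j := by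
    rw [frameMetric_basis_right, e.repr_self, Finsupp.single_apply]
  J_zero := e.ext_elem fun i => by
    fin_cases i <;> simp [h.c0, h.c1, h.c2, h.c3, h.c4, h.c5]
  J_one := e.ext_elem fun i => by
    fin_cases i <;> simp [h.c0, h.c1, h.c2, h.c3, h.c4, h.c5]
  J_two := e.ext_elem fun i => by
    fin_cases i <;> simp [h.c0, h.c1, h.c2, h.c3, h.c4, h.c5]
  J_three := e.ext_elem fun i => by
    fin_cases i <;> simp [h.c0, h.c1, h.c2, h.c3, h.c4, h.c5]
  J_four := e.ext_elem fun i => by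
    fin_cases i <;> simp [h.c0, h.c1, h.c2, h.c3, h.c4, h.c5]
  J_five := e.ext_elem fun i => by
    fin_cases i <;> simp [h.c0, h.c1, h.c2, h.c3, h.c4, h.c5]

theorem JCoords.fundForm_apply (h : JCoords J e) (X Y : 𝔤) :
    fundForm J (frameMetric e) X Y =
      e.repr X 0 * e.repr Y 1 - e.repr X 1 * e.repr Y 0
        + (e.repr X 2 * e.repr Y 3 - e.repr X 3 * e.repr Y 2)
        + (e.repr X 4 * e.repr Y 5 - e.repr X 5 * e.repr Y 4) := by
  simp only [fundForm, frameMetric_apply, Fin.sum_univ_six, h.c0, h.c1, h.c2, h.c3, h.c4, h.c5]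
  ring

/-- The `SU(3)`-connection with connection form `θ`. -/
noncomputable def suThreeConnection (e : Basis (Fin 6) ℝ 𝔤) (θ : 𝔤 →ₗ[ℝ] Fin 8 → ℝ) :
    𝔤 →ₗ[ℝ] 𝔤 →ₗ[ℝ] 𝔤 := suThree e ∘ₗ θ

theorem repr_suThreeConnection (e : Basis (Fin 6) ℝ 𝔤) (θ : 𝔤 →ₗ[ℝ] Fin 8 → ℝ) (X Y : 𝔤)
    (i : Fin 6) : e.repr (suThreeConnection e θ X Y) i = suThreeCoord (θ X) (e.repr Y) i :=
  repr_suThree e (θ X) Y i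

/-- The structure equation Ω = dθ + θ ∧ θ, which reduces curvature to eight scalar 2-forms. -/
theorem curv_suThreeConnection (e : Basis (Fin 6) ℝ 𝔤) (θ : 𝔤 →ₗ[ℝ] Fin 8 → ℝ) (X Y Z : 𝔤) :
    curv (suThreeConnection e θ) X Y Z =
      suThree e (suThreeBracket (θ X) (θ Y) - θ ⁅X, Y⁆) Z := by
  rw [map_sub, LinearMap.sub_apply, ← suThree_bracket]
  rfl

theorem curvForm_suThreeConnection (e : Basis (Fin 6) ℝ 𝔤) (θ : 𝔤 →ₗ[ℝ] Fin 8 → ℝ)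
    (i j : Fin 6) (X Y : 𝔤) :
    curvForm (frameMetric e) e (suThreeConnection e θ) i j X Y =
      suThreeCoord (suThreeBracket (θ X) (θ Y) - θ ⁅X, Y⁆) (Pi.single j 1) i := by
  rw [curvForm, frameMetric_basis_right, curv_suThreeConnection, repr_suThree, e.repr_self,
    Finsupp.single_eq_pi_single]

theorem JCoords.isHermitianConnection (h : JCoords J e) (θ : 𝔤 →ₗ[ℝ] Fin 8 → ℝ) :
    IsHermitianConnection J (frameMetric e) (suThreeConnection e θ) where
  metric X Y Z := by
    simp only [frameMetric_apply, repr_suThreeConnection, Fin.sum_univ_six]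
    simp [suThreeCoord]
    ring
  complex X Y := by
    refine e.ext_elem fun i => ?_
    fin_cases i <;>
      simp [repr_suThreeConnection, suThreeCoord, h.c0, h.c1, h.c2, h.c3, h.c4, h.c5] <;> ring

theorem JCoords.isSU3Connection (h : JCoords J e) (θ : 𝔤 →ₗ[ℝ] Fin 8 → ℝ) :
    IsSU3Connection J (frameMetric e) e (suThreeConnection e θ) where
  hermitian := h.isHermitianConnection θ
  parallel W X Y Z := by
    -- The complex coframe transforms by a skew-Hermitian matrix. Differentiating the determinant Ψ
    -- multiplies it by the trace, here -iθ₆ - iθ₇ + i(θ₆ + θ₇) = 0.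
    have h1 : ∀ V, complexForm (e.coord 0) (e.coord 1) (suThreeConnection e θ W V) =
        -(Complex.I * θ W 6) * complexForm (e.coord 0) (e.coord 1) V
          + (θ W 0 - Complex.I * θ W 1) * complexForm (e.coord 2) (e.coord 3) V
          + (θ W 2 - Complex.I * θ W 3) * complexForm (e.coord 4) (e.coord 5) V := fun V => by
      simp only [complexForm, Basis.coord_apply, repr_suThreeConnection]
      apply Complex.ext <;> simp [suThreeCoord] <;> ring
    have h2 : ∀ V, complexForm (e.coord 2) (e.coord 3) (suThreeConnection e θ W V) =
        -(θ W 0 + Complex.I * θ W 1) * complexForm (e.coord 0) (e.coord 1) V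
          - Complex.I * θ W 7 * complexForm (e.coord 2) (e.coord 3) V
          + (θ W 4 - Complex.I * θ W 5) * complexForm (e.coord 4) (e.coord 5) V := fun V => by
      simp only [complexForm, Basis.coord_apply, repr_suThreeConnection]
      apply Complex.ext <;> simp [suThreeCoord] <;> ring
    have h3 : ∀ V, complexForm (e.coord 4) (e.coord 5) (suThreeConnection e θ W V) =
        -(θ W 2 + Complex.I * θ W 3) * complexForm (e.coord 0) (e.coord 1) V
          - (θ W 4 + Complex.I * θ W 5) * complexForm (e.coord 2) (e.coord 3) V
          + Complex.I * (θ W 6 + θ W 7) * complexForm (e.coord 4) (e.coord 5) V := fun V => by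
      simp only [complexForm, Basis.coord_apply, repr_suThreeConnection]
      apply Complex.ext <;> simp [suThreeCoord] <;> ring
    simp only [volForm, h1, h2, h3, Matrix.det_fin_three]
    simp
    ring

/-- `8π²p₁` of an `SU(3)`-connection in terms of the components `Ω` of its curvature. -/
theorem pontryagin_suThreeConnection (e : Basis (Fin 6) ℝ 𝔤) (θ : 𝔤 →ₗ[ℝ] Fin 8 → ℝ)
    {Ω : Fin 8 → 𝔤 → 𝔤 → ℝ}
    (hΩ : ∀ k X Y, (suThreeBracket (θ X) (θ Y) - θ ⁅X, Y⁆) k = Ω k X Y) (X Y Z W : 𝔤) :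
    pontryagin (frameMetric e) e (suThreeConnection e θ) X Y Z W = 1 / (8 * Real.pi ^ 2) *
      (2 * (wedgeTwo (Ω 0) (Ω 0) X Y Z W + wedgeTwo (Ω 1) (Ω 1) X Y Z W
        + wedgeTwo (Ω 2) (Ω 2) X Y Z W + wedgeTwo (Ω 3) (Ω 3) X Y Z W
        + wedgeTwo (Ω 4) (Ω 4) X Y Z W + wedgeTwo (Ω 5) (Ω 5) X Y Z W)
        + wedgeTwo (Ω 6) (Ω 6) X Y Z W + wedgeTwo (Ω 7) (Ω 7) X Y Z W
        + wedgeTwo (Ω 6 + Ω 7) (Ω 6 + Ω 7) X Y Z W) := by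
  have hs0 : Finset.Ioi (0 : Fin 6) = {1, 2, 3, 4, 5} := by decide
  have hs1 : Finset.Ioi (1 : Fin 6) = {2, 3, 4, 5} := by decide
  have hs2 : Finset.Ioi (2 : Fin 6) = {3, 4, 5} := by decide
  have hs3 : Finset.Ioi (3 : Fin 6) = {4, 5} := by decide
  have hs4 : Finset.Ioi (4 : Fin 6) = {5} := by decide
  have hs5 : Finset.Ioi (5 : Fin 6) = ∅ := by decide
  have hc : ∀ i j, curvForm (frameMetric e) e (suThreeConnection e θ) i j =
      fun X Y => suThreeCoord (fun k => Ω k X Y) (Pi.single j 1) i := fun i j => by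
    funext X Y
    rw [curvForm_suThreeConnection, funext fun k => hΩ k X Y]
  simp only [pontryagin, hc, Fin.sum_univ_six, hs0, hs1, hs2, hs3, hs4, hs5]
  simp [suThreeCoord, wedgeTwo]
  ring

end Frame

/-! ### The anomaly equation in the normal frame -/

section Strominger

variable {𝔤 : Type*} [LieRing 𝔤] [LieAlgebra ℝ 𝔤]

/-- The bracket relations `AdaptedBrackets`, in coordinates. -/
structure BracketCoords (e : Basis (Fin 6) ℝ 𝔤) (p q : ℝ) : Prop where
  c0 : ∀ X Y : 𝔤, e.repr ⁅X, Y⁆ 0 = 0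
  c1 : ∀ X Y : 𝔤, e.repr ⁅X, Y⁆ 1 = 0
  c2 : ∀ X Y : 𝔤, e.repr ⁅X, Y⁆ 2 = -p * (e.repr X 0 * e.repr Y 4 - e.repr X 4 * e.repr Y 0)
  c3 : ∀ X Y : 𝔤, e.repr ⁅X, Y⁆ 3 = -p * (e.repr X 1 * e.repr Y 4 - e.repr X 4 * e.repr Y 1)
  c4 : ∀ X Y : 𝔤, e.repr ⁅X, Y⁆ 4 = 0
  c5 : ∀ X Y : 𝔤, e.repr ⁅X, Y⁆ 5 = -q * (e.repr X 0 * e.repr Y 2 - e.repr X 2 * e.repr Y 0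
    + (e.repr X 1 * e.repr Y 3 - e.repr X 3 * e.repr Y 1))

theorem AdaptedBrackets.bracketCoords {e : Basis (Fin 6) ℝ 𝔤} {p q : ℝ}
    (h : AdaptedBrackets e p q) : BracketCoords e p q := by
  constructor <;> intro X Y <;> have key := h.lie_sum (e.repr X) (e.repr Y) <;>
    rw [e.sum_repr, e.sum_repr] at key <;> rw [key] <;> simp

variable {J : 𝔤 →ₗ[ℝ] 𝔤} {e : Basis (Fin 6) ℝ 𝔤} {p q : ℝ}

theorem BracketCoords.structureEqs (h : BracketCoords e p q) {r s : ℝ} (hp : 2 * s / r = p)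
    (hq : 2 / (r * s) = 1) : StructureEqs e r s q := by
  rw [StructureEqs, hp, hq]
  refine ⟨?_, ?_, ?_, ?_, ?_, ?_⟩ <;> funext X Y <;>
    simp only [dOne, wedgeOne, Basis.coord_apply, h.c0, h.c1, h.c2, h.c3, h.c4, h.c5,
      Pi.zero_apply, Pi.smul_apply, Pi.add_apply, smul_eq_mul] <;> ring

/-- The 2-form `e^i ∧ e^j`. -/
noncomputable def basisTwoForm (e : Basis (Fin 6) ℝ 𝔤) (i j : Fin 6) : 𝔤 → 𝔤 → ℝ :=
  wedgeOne (e.coord i) (e.coord j)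

theorem basisTwoForm_apply (e : Basis (Fin 6) ℝ 𝔤) (i j : Fin 6) (X Y : 𝔤) :
    basisTwoForm e i j X Y = e.repr X i * e.repr Y j - e.repr Y i * e.repr X j := rfl

theorem isBalanced (h : BracketCoords e p q) (hJ : JCoords J e) :
    IsBalanced J (frameMetric e) := by
  funext X Y Z W V
  simp only [dFour, wedgeTwo, hJ.fundForm_apply, h.c0, h.c1, h.c2, h.c3, h.c4, h.c5,
    Pi.zero_apply]
  ring

theorem torsionForm_apply (h : BracketCoords e p q) (hJ : JCoords J e) (X Y Z : 𝔤) :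
    torsionForm J (frameMetric e) X Y Z =
      (q * (basisTwoForm e 0 2 X Y + basisTwoForm e 1 3 X Y)
        + p * (basisTwoForm e 0 3 X Y - basisTwoForm e 1 2 X Y)) * e.repr Z 5
      - (q * (basisTwoForm e 0 2 X Z + basisTwoForm e 1 3 X Z)
        + p * (basisTwoForm e 0 3 X Z - basisTwoForm e 1 2 X Z)) * e.repr Y 5
      + (q * (basisTwoForm e 0 2 Y Z + basisTwoForm e 1 3 Y Z)
        + p * (basisTwoForm e 0 3 Y Z - basisTwoForm e 1 2 Y Z)) * e.repr X 5 := by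
  simp only [torsionForm, dTwo, hJ.fundForm_apply, h.c0, h.c1, h.c2, h.c3, h.c4, h.c5,
    hJ.c0, hJ.c1, hJ.c2, hJ.c3, hJ.c4, hJ.c5, basisTwoForm_apply]
  ring

/-- Only e¹²³⁴ and e¹²⁵⁶ occur, as in the p₁ forms below, so the anomaly equation becomes two scalar
equations. -/
theorem dThree_torsionForm (h : BracketCoords e p q) (hJ : JCoords J e) (X Y Z W : 𝔤) :
    dThree (torsionForm J (frameMetric e)) X Y Z W =
      -2 * q ^ 2 * wedgeTwo (basisTwoForm e 0 1) (basisTwoForm e 2 3) X Y Z W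
      - 2 * p ^ 2 * wedgeTwo (basisTwoForm e 0 1) (basisTwoForm e 4 5) X Y Z W := by
  simp only [dThree, torsionForm_apply h hJ, h.c0, h.c1, h.c2, h.c3, h.c5,
    basisTwoForm_apply, wedgeTwo]
  ring

/-! ### The Bismut connection -/

/-- The connection form of the Bismut connection. -/
noncomputable def bismutForm (e : Basis (Fin 6) ℝ 𝔤) (p q : ℝ) : 𝔤 →ₗ[ℝ] Fin 8 → ℝ :=
  LinearMap.pi ![(-p / 2) • e.coord 4 - q • e.coord 5, (-p / 2) • e.coord 5,
    (-p / 2) • e.coord 2, (p / 2) • e.coord 3, (-p / 2) • e.coord 0, (p / 2) • e.coord 1, 0, 0]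

/-- The components of the curvature of the Bismut connection. -/
noncomputable def bismutCurv (e : Basis (Fin 6) ℝ 𝔤) (p q : ℝ) : Fin 8 → 𝔤 → 𝔤 → ℝ :=
  ![(p ^ 2 / 4 - q ^ 2) • (basisTwoForm e 0 2 + basisTwoForm e 1 3),
    (-(p * q) / 2) • (basisTwoForm e 0 2 + basisTwoForm e 1 3)
      - (p ^ 2 / 4) • (basisTwoForm e 0 3 - basisTwoForm e 1 2),
    (-3 * p ^ 2 / 4) • basisTwoForm e 0 4 - (p * q / 2) • basisTwoForm e 0 5
      - (p ^ 2 / 4) • basisTwoForm e 1 5,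
    (-p ^ 2 / 4) • basisTwoForm e 0 5 + (3 * p ^ 2 / 4) • basisTwoForm e 1 4
      + (p * q / 2) • basisTwoForm e 1 5,
    (p ^ 2 / 4) • basisTwoForm e 2 4 + (p * q / 2) • basisTwoForm e 2 5
      - (p ^ 2 / 4) • basisTwoForm e 3 5,
    (-p ^ 2 / 4) • (basisTwoForm e 2 5 + basisTwoForm e 3 4) - (p * q / 2) • basisTwoForm e 3 5,
    (p ^ 2 / 2) • (basisTwoForm e 4 5 - basisTwoForm e 2 3),
    (-p ^ 2 / 2) • (basisTwoForm e 0 1 + basisTwoForm e 4 5)]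

theorem bismutCurv_eq (h : BracketCoords e p q) (k : Fin 8) (X Y : 𝔤) :
    (suThreeBracket (bismutForm e p q X) (bismutForm e p q Y) - bismutForm e p q ⁅X, Y⁆) k =
      bismutCurv e p q k X Y := by
  fin_cases k <;>
    simp [suThreeBracket, bismutForm, bismutCurv, h.c0, h.c1, h.c2, h.c3, h.c4, h.c5,
      basisTwoForm_apply] <;> ring

theorem isBismut (h : BracketCoords e p q) (hJ : JCoords J e) :
    IsBismut J (frameMetric e) (suThreeConnection e (bismutForm e p q)) where
  hermitian := hJ.isHermitianConnection _
  torsion_eq X Y Z := by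
    simp only [torsionForm_apply h hJ, torsion, frameMetric_apply, map_sub,
      repr_suThreeConnection, Fin.sum_univ_six, h.c0, h.c1, h.c2, h.c3, h.c4, h.c5,
      basisTwoForm_apply]
    simp [suThreeCoord, bismutForm]
    ring

theorem pontryagin_bismut (h : BracketCoords e p q) (X Y Z W : 𝔤) :
    pontryagin (frameMetric e) e (suThreeConnection e (bismutForm e p q)) X Y Z W =
      1 / (8 * Real.pi ^ 2) *
        ((p ^ 2 * q ^ 2 - 4 * q ^ 4)
            * wedgeTwo (basisTwoForm e 0 1) (basisTwoForm e 2 3) X Y Z W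
          - p ^ 4 * wedgeTwo (basisTwoForm e 0 1) (basisTwoForm e 4 5) X Y Z W) := by
  rw [pontryagin_suThreeConnection e _ (bismutCurv_eq h)]
  congr 1
  simp [bismutCurv, wedgeTwo, basisTwoForm_apply]
  ring

/-! ### The Chern connection -/

/-- The connection form of the Chern connection. -/
noncomputable def chernForm (e : Basis (Fin 6) ℝ 𝔤) (p q : ℝ) : 𝔤 →ₗ[ℝ] Fin 8 → ℝ :=
  LinearMap.pi ![(-p / 2) • e.coord 4, (p / 2) • e.coord 5, (-q / 2) • e.coord 3,
    (-q / 2) • e.coord 2, (q / 2) • e.coord 1, (q / 2) • e.coord 0, 0, 0]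

/-- The components of the curvature of the Chern connection. -/
noncomputable def chernCurv (e : Basis (Fin 6) ℝ 𝔤) (p q : ℝ) : Fin 8 → 𝔤 → 𝔤 → ℝ :=
  ![(-q ^ 2 / 4) • (basisTwoForm e 0 2 + basisTwoForm e 1 3),
    (p * q / 2) • (basisTwoForm e 0 2 + basisTwoForm e 1 3)
      + (q ^ 2 / 4) • (basisTwoForm e 0 3 - basisTwoForm e 1 2),
    (p * q / 4) • (basisTwoForm e 0 5 - basisTwoForm e 1 4),
    (-(p * q) / 4) • (basisTwoForm e 0 4 + basisTwoForm e 1 5),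
    (p * q / 4) • (basisTwoForm e 3 4 - basisTwoForm e 2 5),
    (p * q / 4) • (basisTwoForm e 2 4 + basisTwoForm e 3 5),
    (-q ^ 2 / 2) • basisTwoForm e 2 3 - (p ^ 2 / 2) • basisTwoForm e 4 5,
    (-q ^ 2 / 2) • basisTwoForm e 0 1 + (p ^ 2 / 2) • basisTwoForm e 4 5]

theorem chernCurv_eq (h : BracketCoords e p q) (k : Fin 8) (X Y : 𝔤) :
    (suThreeBracket (chernForm e p q X) (chernForm e p q Y) - chernForm e p q ⁅X, Y⁆) k =
      chernCurv e p q k X Y := by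
  fin_cases k <;>
    simp [suThreeBracket, chernForm, chernCurv, h.c0, h.c1, h.c2, h.c3, h.c4, h.c5,
      basisTwoForm_apply] <;> ring

theorem isChern (h : BracketCoords e p q) (hJ : JCoords J e) :
    IsChern J (frameMetric e) (suThreeConnection e (chernForm e p q)) where
  hermitian := hJ.isHermitianConnection _
  torsion_eq X Y := by
    refine e.ext_elem fun i => ?_
    simp only [torsion, map_sub, map_neg, Finsupp.sub_apply, Finsupp.neg_apply,
      repr_suThreeConnection]
    fin_cases i <;>
      simp [suThreeCoord, chernForm, h.c0, h.c1, h.c2, h.c3, h.c4, h.c5, hJ.c0, hJ.c1, hJ.c2,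
        hJ.c3, hJ.c4, hJ.c5] <;> ring

theorem pontryagin_chern (h : BracketCoords e p q) (X Y Z W : 𝔤) :
    pontryagin (frameMetric e) e (suThreeConnection e (chernForm e p q)) X Y Z W =
      1 / (8 * Real.pi ^ 2) *
        (-(p ^ 2 * q ^ 2) * wedgeTwo (basisTwoForm e 0 1) (basisTwoForm e 2 3) X Y Z W
          - p ^ 2 * q ^ 2 * wedgeTwo (basisTwoForm e 0 1) (basisTwoForm e 4 5) X Y Z W) := by
  rw [pontryagin_suThreeConnection e _ (chernCurv_eq h)]
  congr 1
  simp [chernCurv, wedgeTwo, basisTwoForm_apply]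
  ring

/-! ### The instanton -/

/-- The connection form of the reducible instanton with values in a circle in `SU(3)`. -/
noncomputable def instantonForm (e : Basis (Fin 6) ℝ 𝔤) (t : ℝ) : 𝔤 →ₗ[ℝ] Fin 8 → ℝ :=
  LinearMap.pi ![0, 0, 0, 0, 0, 0, t • e.coord 5, -t • e.coord 5]

/-- The components of the curvature of the instanton. -/
noncomputable def instantonCurv (e : Basis (Fin 6) ℝ 𝔤) (q t : ℝ) : Fin 8 → 𝔤 → 𝔤 → ℝ :=
  ![0, 0, 0, 0, 0, 0, (t * q) • (basisTwoForm e 0 2 + basisTwoForm e 1 3),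
    (-(t * q)) • (basisTwoForm e 0 2 + basisTwoForm e 1 3)]

theorem instantonCurv_eq (h : BracketCoords e p q) (t : ℝ) (k : Fin 8) (X Y : 𝔤) :
    (suThreeBracket (instantonForm e t X) (instantonForm e t Y) - instantonForm e t ⁅X, Y⁆) k =
      instantonCurv e q t k X Y := by
  fin_cases k <;>
    simp [suThreeBracket, instantonForm, instantonCurv, h.c5, basisTwoForm_apply] <;> ring

theorem pontryagin_instanton (h : BracketCoords e p q) (t : ℝ) (X Y Z W : 𝔤) :
    pontryagin (frameMetric e) e (suThreeConnection e (instantonForm e t)) X Y Z W =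
      1 / (8 * Real.pi ^ 2) * (-4 * t ^ 2 * q ^ 2
        * wedgeTwo (basisTwoForm e 0 1) (basisTwoForm e 2 3) X Y Z W) := by
  rw [pontryagin_suThreeConnection e _ (instantonCurv_eq h t)]
  congr 1
  simp [instantonCurv, wedgeTwo, basisTwoForm_apply]
  ring

theorem curvForm_instanton (h : BracketCoords e p q) (t : ℝ) (i j : Fin 6) (X Y : 𝔤) :
    curvForm (frameMetric e) e (suThreeConnection e (instantonForm e t)) i j X Y =
      suThreeCoord ![0, 0, 0, 0, 0, 0, t * q, -(t * q)] (Pi.single j 1) i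
        * (basisTwoForm e 0 2 X Y + basisTwoForm e 1 3 X Y) := by
  rw [curvForm_suThreeConnection, funext fun k => instantonCurv_eq h t k X Y]
  fin_cases i <;>
    simp [suThreeCoord, instantonCurv] <;> first | ring1 | (left; ring1)

/-- Every curvature form is a multiple of e¹³ + e²⁴, which is primitive and J-invariant. -/
theorem isInstanton (h : BracketCoords e p q) (hJ : JCoords J e) (t : ℝ) :
    IsInstanton J (frameMetric e) e (suThreeConnection e (instantonForm e t)) where
  su3 := hJ.isSU3Connection _
  primitive i j := by simp [curvForm_instanton h, basisTwoForm_apply]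
  type_one_one i j X Y := by
    simp only [curvForm_instanton h, basisTwoForm_apply, hJ.c0, hJ.c1, hJ.c2, hJ.c3]
    ring

theorem not_isFlat_instanton (h : BracketCoords e p q) {t : ℝ} (ht : t ≠ 0) (hq : q ≠ 0) :
    ¬ IsFlat (suThreeConnection e (instantonForm e t)) := by
  intro hflat
  have h1 := curvForm_instanton h t 0 1 (e 0) (e 2)
  rw [curvForm, hflat] at h1
  simp [suThreeCoord, basisTwoForm_apply, ht, hq] at h1

/-- All conditions on the Hermitian structure hold for every p, q; the anomaly equation alone
constrains them. -/
theorem solvesStrominger (h : BracketCoords e p q) (hJ : JCoords J e)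
    (hJc : IsComplexStructure J) {A D : 𝔤 →ₗ[ℝ] 𝔤 →ₗ[ℝ] 𝔤} {α' : ℝ}
    (hA : IsInstanton J (frameMetric e) e A) (hα : 0 < α')
    (hanomaly : dThree (torsionForm J (frameMetric e)) =
      (2 * Real.pi ^ 2 * α') • (pontryagin (frameMetric e) e D - pontryagin (frameMetric e) e A)) :
    SolvesStrominger J (frameMetric e) e A D α' where
  complexStructure := hJc
  hermitianMetric := hJ.isHermitianMetric
  adapted := hJ.isAdapted
  gravitino := ⟨_, isBismut h hJ, hJ.isSU3Connection _⟩
  dilatino := isBalanced h hJ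
  gaugino := hA
  alpha_pos := hα
  anomaly := hanomaly

/-- The constant is α' = 8/p², read off from the coefficient of e¹²⁵⁶; that of e¹²³⁴ then requires
4t² = 4 - 2p². -/
theorem solvesStrominger_bismut (h : BracketCoords e p q) (hJ : JCoords J e)
    (hJc : IsComplexStructure J) {t : ℝ} (hp : p ^ 2 = 5 / 3) (hq : q ^ 2 = 1)
    (ht : t ^ 2 = 1 / 6) :
    SolvesStrominger J (frameMetric e) e (suThreeConnection e (instantonForm e t))
      (suThreeConnection e (bismutForm e p q)) (24 / 5) := by
  refine solvesStrominger h hJ hJc (isInstanton h hJ t) (by norm_num) ?_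
  have hp4 : p ^ 4 = 25 / 9 := by rw [show p ^ 4 = (p ^ 2) ^ 2 by ring, hp]; norm_num
  have hq4 : q ^ 4 = 1 := by rw [show q ^ 4 = (q ^ 2) ^ 2 by ring, hq]; norm_num
  funext X Y Z W
  simp only [Pi.smul_apply, Pi.sub_apply, smul_eq_mul, dThree_torsionForm h hJ,
    pontryagin_bismut h, pontryagin_instanton h, hp, hq, ht, hp4, hq4]
  field_simp
  ring

/-- Here e¹²⁵⁶ gives α' = 8 whatever p is, and e¹²³⁴ requires 4t² = p² - 1. -/
theorem solvesStrominger_chern (h : BracketCoords e p q) (hJ : JCoords J e)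
    (hJc : IsComplexStructure J) {t : ℝ} (hp : p ^ 2 = 5 / 3) (hq : q ^ 2 = 1)
    (ht : t ^ 2 = 1 / 6) :
    SolvesStrominger J (frameMetric e) e (suThreeConnection e (instantonForm e t))
      (suThreeConnection e (chernForm e p q)) 8 := by
  refine solvesStrominger h hJ hJc (isInstanton h hJ t) (by norm_num) ?_
  funext X Y Z W
  simp only [Pi.smul_apply, Pi.sub_apply, smul_eq_mul, dThree_torsionForm h hJ,
    pontryagin_chern h, pontryagin_instanton h, hp, hq, ht]
  field_simp
  ring

/-- Every complex structure on `𝔥₁₉⁻` carries a solution of the Strominger system for both the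
Bismut and the Chern connection. -/
theorem IsH19Minus.exists_strominger (h : IsH19Minus 𝔤) (hJ : IsComplexStructure J) :
    ∃ g : 𝔤 →ₗ[ℝ] 𝔤 →ₗ[ℝ] ℝ, IsHermitianMetric J g ∧ IsBalanced J g ∧
      ∃ e : Basis (Fin 6) ℝ 𝔤, IsAdapted J g e ∧
        (∃ r s ε : ℝ, r ≠ 0 ∧ s ^ 2 = √(5 / 3) ∧ (ε = 1 ∨ ε = -1) ∧ StructureEqs e r s ε) ∧
        ∃ A B C : 𝔤 →ₗ[ℝ] 𝔤 →ₗ[ℝ] 𝔤, ¬ IsFlat A ∧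
          IsBismut J g B ∧ (∃ α' : ℝ, SolvesStrominger J g e A B α') ∧
          IsChern J g C ∧ (∃ α' : ℝ, SolvesStrominger J g e A C α') := by
  have hp0 : 0 < √(5 / 3 : ℝ) := by positivity
  obtain ⟨e, ε, hε, hb, h0, h2, h4⟩ := h.exists_normalForm hJ hp0
  have hB := hb.bracketCoords
  have hJe := hJ.jCoords h0 h2 h4
  have hp : √(5 / 3 : ℝ) ^ 2 = 5 / 3 := Real.sq_sqrt (by norm_num)
  have hq : ε ^ 2 = 1 := by rcases hε with rfl | rfl <;> norm_num
  have hq0 : ε ≠ 0 := by rcases hε with rfl | rfl <;> norm_num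
  have ht : √(1 / 6 : ℝ) ^ 2 = 1 / 6 := Real.sq_sqrt (by norm_num)
  have ht0 : √(1 / 6 : ℝ) ≠ 0 := by positivity
  have hs : √√(5 / 3 : ℝ) ^ 2 = √(5 / 3) := Real.sq_sqrt hp0.le
  have hs0 : √√(5 / 3 : ℝ) ≠ 0 := by positivity
  -- Taking s² = p and r = 2/s turns 2s/r into p and 2/(rs) into 1, matching the normal form with q
  -- = ε.
  refine ⟨frameMetric e, hJe.isHermitianMetric, isBalanced hB hJe, e, hJe.isAdapted,
    ⟨2 / √√(5 / 3), √√(5 / 3), ε, div_ne_zero two_ne_zero hs0, hs, hε,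
      hB.structureEqs ?_ ?_⟩,
    _, _, _, not_isFlat_instanton hB ht0 hq0, isBismut hB hJe,
    ⟨_, solvesStrominger_bismut hB hJe hJ hp hq ht⟩, isChern hB hJe,
    ⟨_, solvesStrominger_chern hB hJe hJ hp hq ht⟩⟩
  · field_simp
    exact hs
  · field_simp

end Strominger

end InvGeom

theorem proposition5p7
    {G : Type*} [Group G] [TopologicalSpace G] [ChartedSpace (EuclideanSpace ℝ (Fin 6)) G]
    [LieGroup (𝓡 6) ∞ G] [SimplyConnectedSpace G]
    (Γ : Subgroup G) [DiscreteTopology Γ]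
    [CompactSpace (Quotient (QuotientGroup.rightRel Γ))]
    (hG : InvGeom.IsH19Minus (GroupLieAlgebra (𝓡 6) G))
    (J : GroupLieAlgebra (𝓡 6) G →ₗ[ℝ] GroupLieAlgebra (𝓡 6) G)
    (hJ : InvGeom.IsComplexStructure J) :
    ∃ g : GroupLieAlgebra (𝓡 6) G →ₗ[ℝ] GroupLieAlgebra (𝓡 6) G →ₗ[ℝ] ℝ,
      InvGeom.IsHermitianMetric J g ∧ InvGeom.IsBalanced J g ∧
      ∃ e : Module.Basis (Fin 6) ℝ (GroupLieAlgebra (𝓡 6) G),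
        InvGeom.IsAdapted J g e ∧
        (∃ r s ε : ℝ, r ≠ 0 ∧ s ^ 2 = √(5 / 3) ∧ (ε = 1 ∨ ε = -1) ∧
          InvGeom.StructureEqs e r s ε) ∧
        ∃ A B C : GroupLieAlgebra (𝓡 6) G →ₗ[ℝ] GroupLieAlgebra (𝓡 6) G →ₗ[ℝ]
            GroupLieAlgebra (𝓡 6) G,
          ¬ InvGeom.IsFlat A ∧
          InvGeom.IsBismut J g B ∧ (∃ α' : ℝ, InvGeom.SolvesStrominger J g e A B α') ∧
          InvGeom.IsChern J g C ∧ (∃ α' : ℝ, InvGeom.SolvesStrominger J g e A C α') := by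
  exact hG.exists_strominger hJ
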